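/- Let $1\to G\xrightarrow{i} H\xrightarrow{j} Q\to 1$ be an extension of finite groups; identify $G$ with $i(G)\subseteq H$. Choose a set-theoretic section $s:Q\to H$ of $j$ with $s(1)=1$, and put $\tau(q_1,q_2)=s(q_1)s(q_2)s(q_1q_2)^{-1}\in G$. Let $\widehat G$ be the set of isomorphism classes of irreducible complex linear representations of $G$. The group $Q$ acts on $\widehat G$ (from the right, although we write the action on the left): $q([\rho])$ is the class of $g\mapsto\rho(s(q)gs(q)^{-1})$. For every class in $\widehat G$ choose a unitary representation $\rho:G\to \mathrm{End}(V_\rho)$ in the class; the chosen representation in the class $q([\rho])$ is again denoted by $q([\rho])$. For every $q\in Q$ and $[\rho]\in\widehat G$ choose a unitary isomorphism $T_q^{[\rho]}:V_\rho\to V_{q([\rho])}$ with $$T_q^{[\rho]}\,\rho(s(q)gs(q)^{-1})=q([\rho])(g)\,T_q^{[\rho]}\quad (g\in G),\qquad T_1^{[\rho]}=\mathrm{id}.$$ There are unique scalars $c^{[\rho]}(q_1,q_2)\in U(1)$ with $$T^{q_1([\rho])}_{q_2}\,T^{[\rho]}_{q_1}=c^{[\rho]}(q_1,q_2)\,T^{[\rho]}_{q_1q_2}\,\rho(\tau(q_1,q_2))^{-1}.$$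 Let $q\in Q$. Let $C(q)\subseteq Q$ be the centralizer of $q$, let $\widehat G^q\subseteq\widehat G$ be the set of classes fixed by $q$, on which $C(q)$ acts, and let $\mathrm{Stab}_{C(q)}([\rho])$ be the stabilizer of $[\rho]$ in $C(q)$. For $[\rho]\in\widehat G^q$ and $q_1\in C(q)$ put $$\gamma^{[\rho]}_{q_1,q}=c^{[\rho]}(q_1,q)\,c^{[\rho]}(q,q_1)^{-1}.$$ Then, for all such choices, the number of conjugacy classes of $H$ that $j$ maps to the conjugacy class $\langle q\rangle$ of $Q$ is equal to the number of $C(q)$-orbits $O$ of $\widehat G^q$ for which there exists $[\rho]\in O$ such that $\gamma^{[\rho]}_{q_1,q}=1$ for all $q_1\in \mathrm{Stab}_{C(q)}([\rho])$. -/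

import Mathlib

universe u v w

namespace ExtensionDual

section Dual

/-- A finite-dimensional irreducible complex linear representation of `G`. -/
structure IrrRep (G : Type u) [Group G] where
  V : Type
  [addCommGroup : AddCommGroup V]
  [module : Module ℂ V]
  [finiteDimensional : FiniteDimensional ℂ V]
  ρ : Representation ℂ G V
  irr : ρ.IsIrreducible

attribute [instance] IrrRep.addCommGroup IrrRep.module IrrRep.finiteDimensional

/-- Isomorphism of representations. -/
instance irrSetoid (G : Type u) [Group G] : Setoid (IrrRep G) where
  r A B := Nonempty (A.ρ.Equiv B.ρ)
  iseqv :=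
    { refl := fun A => ⟨Representation.Equiv.refl A.ρ⟩
      symm := fun ⟨e⟩ => ⟨e.symm⟩
      trans := fun ⟨e⟩ ⟨f⟩ => ⟨e.trans f⟩ }

/-- The set `Ĝ` of isomorphism classes of irreducible complex representations of `G`. -/
def Dual (G : Type u) [Group G] := Quotient (irrSetoid G)

/-- The isomorphism class `[ρ]` of an irreducible representation. -/
def Dual.mk {G : Type u} [Group G] {V : Type} [AddCommGroup V] [Module ℂ V]
    [FiniteDimensional ℂ V] (ρ : Representation ℂ G V) (h : ρ.IsIrreducible) : Dual G :=
  Quotient.mk (irrSetoid G) { V := V, ρ := ρ, irr := h }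

/-- The twist `g ↦ ρ (a g)` of a representation by an automorphism `a` of `G`. -/
def twist {G : Type u} [Group G] {V : Type} [AddCommGroup V] [Module ℂ V]
    (ρ : Representation ℂ G V) (a : MulAut G) : Representation ℂ G V :=
  MonoidHom.comp ρ a.toMonoidHom

theorem twist_apply {G : Type u} [Group G] {V : Type} [AddCommGroup V] [Module ℂ V]
    (ρ : Representation ℂ G V) (a : MulAut G) (g : G) : twist ρ a g = ρ (a g) := rfl

/-- A representation and its twist have the same invariant subspaces. -/
def twistSubrep {G : Type u} [Group G] {V : Type} [AddCommGroup V] [Module ℂ V]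
    (ρ : Representation ℂ G V) (a : MulAut G) :
    Subrepresentation (twist ρ a) ≃o Subrepresentation ρ where
  toFun W := ⟨W.toSubmodule, fun g v hv => by
    have h := W.apply_mem_toSubmodule (a.symm g) hv
    rwa [twist_apply, MulEquiv.apply_symm_apply] at h⟩
  invFun W := ⟨W.toSubmodule, fun g v hv => W.apply_mem_toSubmodule (a g) hv⟩
  left_inv _ := rfl
  right_inv _ := rfl
  map_rel_iff' := Iff.rfl

theorem twist_irreducible {G : Type u} [Group G] {V : Type} [AddCommGroup V] [Module ℂ V]
    (ρ : Representation ℂ G V) (a : MulAut G) (h : ρ.IsIrreducible) :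
    (twist ρ a).IsIrreducible :=
  (OrderIso.isSimpleOrder_iff (twistSubrep ρ a)).2 h

/-- The class `[ρ ∘ a]`, as a function of the class `[ρ]`. -/
def Dual.twist {G : Type u} [Group G] (a : MulAut G) : Dual G → Dual G :=
  Quotient.map
    (fun A => { V := A.V, ρ := ExtensionDual.twist A.ρ a, irr := twist_irreducible A.ρ a A.irr })
    (fun _ _ ⟨e⟩ => ⟨Representation.Equiv.mk e.toLinearEquiv fun g => e.isIntertwining' (a g)⟩)

theorem Dual.twist_mul {G : Type u} [Group G] (a b : MulAut G) (x : Dual G) :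
    Dual.twist (a * b) x = Dual.twist b (Dual.twist a x) := by
  induction x using Quotient.inductionOn with
  | h A => rfl

/-- Twisting by an inner automorphism does not change the isomorphism class. -/
theorem Dual.twist_conj {G : Type u} [Group G] (g : G) (x : Dual G) :
    Dual.twist (MulAut.conj g) x = x := by
  induction x using Quotient.inductionOn with
  | h A =>
    refine Quotient.sound ⟨Representation.Equiv.mk
      (LinearEquiv.ofLinearMap (A.ρ g⁻¹) (A.ρ g) ?_ ?_) fun k => ?_⟩
    · rw [← Module.End.mul_eq_comp, ← map_mul]; simp [Module.End.one_eq_id]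
    · rw [← Module.End.mul_eq_comp, ← map_mul]; simp [Module.End.one_eq_id]
    · change A.ρ g⁻¹ * A.ρ (g * k * g⁻¹) = A.ρ k * A.ρ g⁻¹
      rw [← map_mul, ← map_mul]
      congr 1
      group

end Dual

section Extension

variable {G : Type u} {H : Type v} {Q : Type w} [Group G] [Group H] [Group Q]
  {S : GroupExtension G H Q}

theorem exists_tau (s : S.Section) (q₁ q₂ : Q) :
    ∃ g : G, S.inl g = s q₁ * s q₂ * (s (q₁ * q₂))⁻¹ :=
  s.mul_mul_mul_inv_mem_range_inl q₁ q₂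

/-- The element `τ(q₁, q₂) = s(q₁) s(q₂) s(q₁ q₂)⁻¹` of `G`. -/
noncomputable def tau (s : S.Section) (q₁ q₂ : Q) : G := (exists_tau s q₁ q₂).choose

theorem inl_tau (s : S.Section) (q₁ q₂ : Q) :
    S.inl (tau s q₁ q₂) = s q₁ * s q₂ * (s (q₁ * q₂))⁻¹ := (exists_tau s q₁ q₂).choose_spec

theorem conjAct_inl (g : G) : S.conjAct (S.inl g) = MulAut.conj g := by
  ext k
  apply S.inl_injective
  rw [S.inl_conjAct_comm]
  simp

theorem conjAct_mul_section (s : S.Section) (q₁ q₂ : Q) :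
    S.conjAct (s q₁) * S.conjAct (s q₂) =
      MulAut.conj (tau s q₁ q₂) * S.conjAct (s (q₁ * q₂)) := by
  rw [← conjAct_inl (S := S), inl_tau, ← map_mul S.conjAct, ← map_mul S.conjAct,
    inv_mul_cancel_right]

/-- The action of `q ∈ Q` on `Ĝ`: it sends `[ρ]` to the class of `g ↦ ρ (s(q) g s(q)⁻¹)`. -/
noncomputable def act (s : S.Section) (q : Q) (x : Dual G) : Dual G :=
  Dual.twist (S.conjAct (s q)) x

theorem act_one (s : S.Section) (x : Dual G) : act s 1 x = x := by
  obtain ⟨g, hg⟩ : s 1 ∈ S.inl.range := by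
    rw [S.range_inl_eq_ker_rightHom, MonoidHom.mem_ker, GroupExtension.Section.rightHom_section]
  rw [act, ← hg, conjAct_inl, Dual.twist_conj]

/-- `act` is a right action, written on the left. -/
theorem act_mul (s : S.Section) (q₁ q₂ : Q) (x : Dual G) :
    act s (q₁ * q₂) x = act s q₂ (act s q₁ x) := by
  unfold act
  rw [← Dual.twist_mul, conjAct_mul_section, Dual.twist_mul, Dual.twist_conj]

/-- The set `Ĝ^q` of classes fixed by `q`. -/
def fixedBy (s : S.Section) (q : Q) : Set (Dual G) := {x | act s q x = x}

/-- The orbit of `x` under the centralizer `C(q)`. -/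
def orbit (s : S.Section) (q : Q) (x : Dual G) : Set (Dual G) :=
  {y | ∃ p ∈ Subgroup.centralizer {q}, act s p x = y}

/-- The stabilizer of `x` in the centralizer `C(q)`. -/
def stab (s : S.Section) (q : Q) (x : Dual G) : Set Q :=
  {p | p ∈ Subgroup.centralizer {q} ∧ act s p x = x}

/-- The set of `C(q)`-orbits of `Ĝ^q`. -/
def orbits (s : S.Section) (q : Q) : Set (Set (Dual G)) :=
  orbit s q '' fixedBy s q

/-- The choices made to define the cocycle: for every class `x ∈ Ĝ` a unitary representation
`rep x` on a space `V x` in the class `x`, and for every arrow `x → y` of the groupoid `Ĝ ⋊ Q`,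
that is, every `q ∈ Q` and `x ∈ Ĝ` with `y = q(x)`, a unitary isomorphism
`T_q^x : V x → V y` which intertwines `g ↦ rep x (s(q) g s(q)⁻¹)` and `rep y`; moreover
`T_1^x` is the identity. -/
structure Choices (s : S.Section) where
  V : Dual G → Type
  [normed : ∀ x, NormedAddCommGroup (V x)]
  [inner : ∀ x, InnerProductSpace ℂ (V x)]
  [finiteDimensional : ∀ x, FiniteDimensional ℂ (V x)]
  rep : ∀ x, Representation ℂ G (V x)
  irr : ∀ x, (rep x).IsIrreducible
  mk_rep : ∀ x, Dual.mk (rep x) (irr x) = x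
  norm_rep : ∀ x g (a : V x), ‖rep x g a‖ = ‖a‖
  T : ∀ (q : Q) (x y : Dual G), act s q x = y → (V x ≃ₗᵢ[ℂ] V y)
  T_rep : ∀ (q : Q) (x y : Dual G) (h : act s q x = y) (g : G) (a : V x),
    T q x y h (rep x (S.conjAct (s q) g) a) = rep y g (T q x y h a)
  T_one : ∀ (x : Dual G) (h : act s 1 x = x), T 1 x x h = LinearIsometryEquiv.refl ℂ (V x)

attribute [instance] Choices.normed Choices.inner Choices.finiteDimensional

variable {s : S.Section}

/-- By Schur's lemma, `T_{q₂}^{q₁(x)} T_{q₁}^x` is a unique unit scalar times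
`T_{q₁q₂}^x ρ(τ(q₁, q₂))⁻¹`. -/
theorem Choices.existsUnique_c (D : Choices s) (x : Dual G) (q₁ q₂ : Q) :
    ∃! c : Circle, ∀ a : D.V x,
      D.T q₂ (act s q₁ x) (act s q₂ (act s q₁ x)) rfl (D.T q₁ x (act s q₁ x) rfl a) =
        (c : ℂ) • D.T (q₁ * q₂) x (act s q₂ (act s q₁ x)) (act_mul s q₁ q₂ x)
          (D.rep x (tau s q₁ q₂)⁻¹ a) := by
  set z := act s q₂ (act s q₁ x) with hz
  set A : D.V x → D.V z := fun a => D.T q₂ (act s q₁ x) z rfl (D.T q₁ x (act s q₁ x) rfl a) with hA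
  set U := D.T (q₁ * q₂) x z (act_mul s q₁ q₂ x) with hU
  set t := tau s q₁ q₂ with ht
  have key : ∀ g, S.conjAct (s q₁) (S.conjAct (s q₂) g) =
      t * S.conjAct (s (q₁ * q₂)) g * t⁻¹ := fun g => by
    have := congrArg (fun a : MulAut G => a g) (conjAct_mul_section s q₁ q₂)
    simpa using this
  have hmul : ∀ (g k : G) (a : D.V x), D.rep x (g * k) a = D.rep x g (D.rep x k a) := by
    intro g k a; rw [map_mul]; rfl
  have hAg : ∀ g a, A (D.rep x (t * S.conjAct (s (q₁ * q₂)) g * t⁻¹) a) = D.rep z g (A a) := by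
    intro g a
    rw [← key]
    simp only [hA, D.T_rep]
  let F : D.V x →ₗ[ℂ] D.V x :=
    D.rep x t ∘ₗ U.symm.toLinearEquiv.toLinearMap ∘ₗ
      (D.T q₂ (act s q₁ x) z rfl).toLinearEquiv.toLinearMap ∘ₗ
      (D.T q₁ x (act s q₁ x) rfl).toLinearEquiv.toLinearMap
  have hF : ∀ a, F a = D.rep x t (U.symm (A a)) := fun a => rfl
  have hUs : ∀ g b, U.symm (D.rep z g b) = D.rep x (S.conjAct (s (q₁ * q₂)) g) (U.symm b) := by
    intro g b
    apply U.injective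
    rw [D.T_rep, U.apply_symm_apply, U.apply_symm_apply]
  have hcomm : ∀ k a, F (D.rep x k a) = D.rep x k (F a) := by
    intro k a
    obtain ⟨g, hg⟩ := (S.conjAct (s (q₁ * q₂))).surjective (t⁻¹ * k * t)
    have hk : k = t * S.conjAct (s (q₁ * q₂)) g * t⁻¹ := by rw [hg]; group
    rw [hF, hF]
    nth_rewrite 1 [hk]
    rw [hAg, hUs, hg, ← hmul, ← hmul]
    congr 2
    group
  have := D.irr x
  obtain ⟨c, hc⟩ :=
    (Representation.IsIrreducible.algebraMap_intertwiningMap_bijective_of_isAlgClosed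
      (ρ := D.rep x)).2
      (LinearMap.intertwiningMap_of_isIntertwiningMap (D.rep x) (D.rep x) F hcomm)
  have hFc : ∀ a, F a = c • a := fun a => by
    have := congrArg (fun f => f a) hc
    simpa using this.symm
  have hAc : ∀ a, A a = c • U (D.rep x t⁻¹ a) := by
    intro a
    have h1 : D.rep x t⁻¹ (F a) = U.symm (A a) := by
      rw [hF, ← hmul, inv_mul_cancel, map_one]; rfl
    rw [hFc, map_smul] at h1
    rw [← map_smul, h1, U.apply_symm_apply]
  obtain ⟨W, W', hne⟩ := exists_pair_ne (Subrepresentation (D.rep x))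
  obtain ⟨a, ha⟩ : ∃ a : D.V x, a ≠ 0 := by
    by_contra hcon
    push Not at hcon
    apply hne
    ext a
    rw [hcon a]
    exact ⟨fun _ => W'.toSubmodule.zero_mem, fun _ => W.toSubmodule.zero_mem⟩
  have hnorm : ∀ a, ‖A a‖ = ‖a‖ := fun a => by simp [hA]
  have hBn : ∀ a, ‖U (D.rep x t⁻¹ a)‖ = ‖a‖ := fun a => by
    rw [LinearIsometryEquiv.norm_map, D.norm_rep]
  have ha' : ‖a‖ ≠ 0 := norm_ne_zero_iff.2 ha
  have hc1 : ‖c‖ = 1 := by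
    have h := hnorm a
    rw [hAc, norm_smul, hBn] at h
    exact (mul_eq_right₀ ha').1 h
  refine ⟨⟨c, mem_sphere_zero_iff_norm.2 hc1⟩, hAc, fun d hd => ?_⟩
  apply Circle.ext
  have h := (hd a).symm.trans (hAc a)
  have hb : U (D.rep x t⁻¹ a) ≠ 0 := by
    rw [← norm_ne_zero_iff, hBn]
    exact ha'
  exact smul_left_injective ℂ hb h

/-- The cocycle `c^x(q₁, q₂) ∈ U(1)` on the groupoid `Ĝ ⋊ Q`, defined by
`T_{q₂}^{q₁(x)} T_{q₁}^x = c^x(q₁, q₂) T_{q₁q₂}^x ρ(τ(q₁, q₂))⁻¹`, where `ρ = rep x`. -/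
noncomputable def Choices.c (D : Choices s) (x : Dual G) (q₁ q₂ : Q) : Circle :=
  (D.existsUnique_c x q₁ q₂).choose

theorem Choices.c_spec (D : Choices s) (x : Dual G) (q₁ q₂ : Q) (a : D.V x) :
    D.T q₂ (act s q₁ x) (act s q₂ (act s q₁ x)) rfl (D.T q₁ x (act s q₁ x) rfl a) =
      (D.c x q₁ q₂ : ℂ) • D.T (q₁ * q₂) x (act s q₂ (act s q₁ x)) (act_mul s q₁ q₂ x)
        (D.rep x (tau s q₁ q₂)⁻¹ a) :=
  (D.existsUnique_c x q₁ q₂).choose_spec.1 a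

/-- `γ^x_{q₁, q} = c^x(q₁, q) c^x(q, q₁)⁻¹`. -/
noncomputable def Choices.gamma (D : Choices s) (x : Dual G) (q₁ q : Q) : Circle :=
  D.c x q₁ q * (D.c x q q₁)⁻¹

end Extension

end ExtensionDual

/-! Write `j` for `S.rightHom`. The maps `T_q` extend to arrows `V x → V y` for all `h : H`, where
`y = j(h)(x)`, and these compose up to the cocycle `c`. For `x` fixed by `q`, the traces of the
loops at `x` over `q` form a function `χ_x` on the fiber `j⁻¹(q)`.

Schur orthogonality, with the operator `T_q` inserted, makes the `χ_x` orthogonal to the traces of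
the inverse loops. They also detect every class function `F` on the fiber: pairing `F` with `χ_x`
gives the trace of an intertwiner built from `F`, so if all pairings vanish, then so do the
intertwiners, and `F = 0` by semisimplicity of `ℂ[G]`.

Conjugation by `k` over `p ∈ C(q)` carries `χ_x` to `χ_{p(x)}` up to `γ^x_{p,q}` (`chi_conj`). Hence
the pairing of a class function with `χ_x` is determined up to a unit by the orbit of `x`, and it
vanishes if `γ ≠ 1` somewhere on the stabilizer. So class functions over `⟨q⟩` embed into functions
on the good orbits. Conversely, summing the conjugates of the inverse trace at a representative of
each good orbit gives class functions whose pairings form an invertible diagonal matrix. The two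
counts therefore agree (`card_eq_of_diagonal`). -/

namespace ExtensionDual

/-! ### Schur's lemma and Schur orthogonality with inserted operators. -/

section RepresentationTheory

variable {G : Type u} [Group G] {V : Type v} {W : Type w} [AddCommGroup V] [Module ℂ V]
  [AddCommGroup W] [Module ℂ W]

/-- Schur's lemma: an endomorphism of an irreducible representation is a scalar. -/
theorem exists_eq_smul_one_of_commute [FiniteDimensional ℂ V] {ρ : Representation ℂ G V}
    (hρ : ρ.IsIrreducible) (f : V →ₗ[ℂ] V) (hf : ∀ g v, f (ρ g v) = ρ g (f v)) : ∃ c : ℂ, f = c • 1 := by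
  obtain ⟨c, hc⟩ :=
    (Representation.IsIrreducible.algebraMap_intertwiningMap_bijective_of_isAlgClosed
      (ρ := ρ)).2 (LinearMap.intertwiningMap_of_isIntertwiningMap ρ ρ f hf)
  refine ⟨c, LinearMap.ext fun v => ?_⟩
  have := congrArg (fun f => f v) hc
  simpa using this.symm

/-- Schur's lemma: there is no nonzero map between inequivalent irreducible representations. -/
theorem eq_zero_of_intertwining {ρ : Representation ℂ G V} {σ : Representation ℂ G W}
    (hρ : ρ.IsIrreducible) (hσ : σ.IsIrreducible) (h : ¬ Nonempty (ρ.Equiv σ))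
    (f : V →ₗ[ℂ] W) (hf : ∀ g v, f (ρ g v) = σ g (f v)) : f = 0 := by
  rcases Representation.IsIrreducible.bijective_or_eq_zero
    (LinearMap.intertwiningMap_of_isIntertwiningMap ρ σ f hf) with hb | h0
  · exact absurd ⟨Representation.IntertwiningMap.ofBijective _ hb⟩ h
  · exact congrArg Representation.IntertwiningMap.toLinearMap h0

theorem nontrivial_of_isIrreducible {ρ : Representation ℂ G V} (hρ : ρ.IsIrreducible) :
    Nontrivial V := by
  by_contra hV
  rw [not_nontrivial_iff_subsingleton] at hV
  obtain ⟨A, B, hne⟩ := exists_pair_ne (Subrepresentation ρ)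
  exact hne (Subrepresentation.toSubmodule_injective (Subsingleton.elim _ _))

theorem finrank_ne_zero_of_isIrreducible [FiniteDimensional ℂ V] {ρ : Representation ℂ G V}
    (hρ : ρ.IsIrreducible) :
    (Module.finrank ℂ V : ℂ) ≠ 0 := by
  have := nontrivial_of_isIrreducible hρ
  exact_mod_cast Module.finrank_pos.ne'

section Average

variable [Fintype G]

/-- The average (without normalization) of a linear map over the group. -/
def average (ρ : Representation ℂ G V) (σ : Representation ℂ G W) (C : W →ₗ[ℂ] V) :
    W →ₗ[ℂ] V :=
  ∑ g, ρ g ∘ₗ C ∘ₗ σ g⁻¹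

theorem average_apply (ρ : Representation ℂ G V) (σ : Representation ℂ G W) (C : W →ₗ[ℂ] V)
    (w : W) : average ρ σ C w = ∑ g, ρ g (C (σ g⁻¹ w)) := by
  simp [average, LinearMap.sum_apply]

theorem average_intertwining (ρ : Representation ℂ G V) (σ : Representation ℂ G W)
    (C : W →ₗ[ℂ] V) (g : G) (w : W) :
    average ρ σ C (σ g w) = ρ g (average ρ σ C w) := by
  rw [average_apply, average_apply, map_sum]
  refine Fintype.sum_equiv (Equiv.mulLeft g⁻¹) _ _ fun k => ?_
  rw [Equiv.coe_mulLeft, ← Module.End.mul_apply (ρ g), ← map_mul, mul_inv_cancel_left,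
    ← Module.End.mul_apply (σ k⁻¹), ← map_mul, mul_inv_rev, inv_inv]

theorem average_eq_zero {ρ : Representation ℂ G V} {σ : Representation ℂ G W}
    (hρ : ρ.IsIrreducible) (hσ : σ.IsIrreducible) (h : ¬ Nonempty (σ.Equiv ρ))
    (C : W →ₗ[ℂ] V) : average ρ σ C = 0 :=
  eq_zero_of_intertwining hσ hρ h _ (average_intertwining ρ σ C)

theorem trace_average [FiniteDimensional ℂ V] (ρ : Representation ℂ G V) (C : V →ₗ[ℂ] V) :
    LinearMap.trace ℂ V (average ρ ρ C) = Fintype.card G * LinearMap.trace ℂ V C := by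
  have : ∀ g, LinearMap.trace ℂ V (ρ g ∘ₗ C ∘ₗ ρ g⁻¹) = LinearMap.trace ℂ V C := fun g => by
    rw [LinearMap.trace_comp_comm', LinearMap.comp_assoc, ← Module.End.mul_eq_comp (ρ g⁻¹),
      ← map_mul, inv_mul_cancel, map_one, Module.End.one_eq_id, LinearMap.comp_id]
  simp [average, map_sum, this]

/-- The average is an intertwiner, hence a scalar, and its trace determines the scalar. -/
theorem average_eq_smul [FiniteDimensional ℂ V] {ρ : Representation ℂ G V}
    (hρ : ρ.IsIrreducible) (C : V →ₗ[ℂ] V) :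
    average ρ ρ C =
      (Fintype.card G * LinearMap.trace ℂ V C / Module.finrank ℂ V : ℂ) • 1 := by
  obtain ⟨c, hc⟩ := exists_eq_smul_one_of_commute hρ _ (average_intertwining ρ ρ C)
  have h := trace_average ρ C
  rw [hc, map_smul, LinearMap.trace_one, smul_eq_mul] at h
  rw [hc, ← h, mul_div_cancel_right₀ _ (finrank_ne_zero_of_isIrreducible hρ)]

theorem trace_eq_sum_coord {ι : Type*} [Fintype ι] (b : Module.Basis ι ℂ V)
    (f : V →ₗ[ℂ] V) : LinearMap.trace ℂ V f = ∑ i, b.coord i (f (b i)) := by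
  classical
  rw [LinearMap.trace_eq_matrix_trace ℂ b, Matrix.trace]
  simp [LinearMap.toMatrix_apply]

/-- Expanding both traces in bases, the `(i, k)` term is a coordinate of `ρ g ∘ C ∘ σ g⁻¹` for the
rank one map `C w = b'.coord k (B w) • A (b i)`. Summing over `g` gives an average, to which Schur's
lemma applies. -/
theorem sum_trace_mul_trace {ι κ : Type*} [Fintype ι] [Fintype κ] (ρ : Representation ℂ G V)
    (σ : Representation ℂ G W) (A : V →ₗ[ℂ] V) (B : W →ₗ[ℂ] W) (b : Module.Basis ι ℂ V)
    (b' : Module.Basis κ ℂ W) :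
    ∑ g, LinearMap.trace ℂ V (ρ g ∘ₗ A) * LinearMap.trace ℂ W (B ∘ₗ σ g⁻¹) =
      ∑ i, ∑ k, b.coord i
        (average ρ σ ((b'.coord k ∘ₗ B).smulRight (A (b i))) (b' k)) := by
  simp_rw [trace_eq_sum_coord b, trace_eq_sum_coord b', Finset.sum_mul_sum, average_apply, map_sum]
  rw [Finset.sum_comm]
  refine Finset.sum_congr rfl fun i _ => ?_
  rw [Finset.sum_comm]
  refine Finset.sum_congr rfl fun k _ => Finset.sum_congr rfl fun g _ => ?_
  simp [mul_comm]

/-- Schur orthogonality for inequivalent representations. -/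
theorem sum_trace_mul_trace_eq_zero [FiniteDimensional ℂ V] [FiniteDimensional ℂ W]
    {ρ : Representation ℂ G V} {σ : Representation ℂ G W} (hρ : ρ.IsIrreducible)
    (hσ : σ.IsIrreducible) (h : ¬ Nonempty (σ.Equiv ρ))
    (A : V →ₗ[ℂ] V) (B : W →ₗ[ℂ] W) :
    ∑ g, LinearMap.trace ℂ V (ρ g ∘ₗ A) * LinearMap.trace ℂ W (B ∘ₗ σ g⁻¹) = 0 := by
  rw [sum_trace_mul_trace ρ σ A B (Module.finBasis ℂ V) (Module.finBasis ℂ W)]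
  simp [average_eq_zero hρ hσ h]

/-- Schur orthogonality for one irreducible representation. -/
theorem sum_trace_mul_trace_self [FiniteDimensional ℂ V] {ρ : Representation ℂ G V}
    (hρ : ρ.IsIrreducible) (A B : V →ₗ[ℂ] V) :
    ∑ g, LinearMap.trace ℂ V (ρ g ∘ₗ A) * LinearMap.trace ℂ V (B ∘ₗ ρ g⁻¹) =
      Fintype.card G * LinearMap.trace ℂ V (B ∘ₗ A) / Module.finrank ℂ V := by
  set b := Module.finBasis ℂ V
  rw [sum_trace_mul_trace ρ ρ A B b b, trace_eq_sum_coord b (B ∘ₗ A), Finset.mul_sum,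
    Finset.sum_div]
  refine Finset.sum_congr rfl fun i _ => ?_
  -- The average is a scalar, so the `i`-th coordinate of its value at `b k` vanishes for `k ≠ i`.
  rw [Finset.sum_eq_single i]
  · simp [average_eq_smul hρ]
  · intro k _ hk
    simp [average_eq_smul hρ, Finsupp.single_eq_of_ne hk.symm]
  · simp

end Average

/-! ### Faithfulness of the irreducible representations on the group algebra. -/

section Maschke

open scoped MonoidAlgebra

/-- The transport of a representation along a linear equivalence. -/
def transport (ρ : Representation ℂ G V) (e : V ≃ₗ[ℂ] W) : Representation ℂ G W :=
  (LinearEquiv.conjAlgEquiv ℂ e : Module.End ℂ V →* Module.End ℂ W).comp ρ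

theorem transport_apply (ρ : Representation ℂ G V) (e : V ≃ₗ[ℂ] W) (g : G) (w : W) :
    transport ρ e g w = e (ρ g (e.symm w)) := rfl

theorem transport_isIrreducible {ρ : Representation ℂ G V} (hρ : ρ.IsIrreducible)
    (e : V ≃ₗ[ℂ] W) : (transport ρ e).IsIrreducible := by
  let i : Subrepresentation ρ ≃o Subrepresentation (transport ρ e) :=
    { toFun := fun U => ⟨U.toSubmodule.comap e.symm.toLinearMap, fun g v hv => by
        simpa [transport_apply] using U.apply_mem_toSubmodule g hv⟩
      invFun := fun U => ⟨U.toSubmodule.comap e.toLinearMap, fun g v hv => by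
        simpa [transport_apply] using U.apply_mem_toSubmodule g hv⟩
      left_inv := fun U => Subrepresentation.toSubmodule_injective (by ext; simp)
      right_inv := fun U => Subrepresentation.toSubmodule_injective (by ext; simp)
      map_rel_iff' := fun {U U'} =>
        ⟨fun h v hv => by
          have h' : e.symm (e v) ∈ U'.toSubmodule :=
            h (show e.symm (e v) ∈ U.toSubmodule by rwa [e.symm_apply_apply])
          rwa [e.symm_apply_apply] at h',
          fun h v hv => h hv⟩ }
  exact (OrderIso.isSimpleOrder_iff i).1 hρ

theorem ofModule'_isIrreducible (M : Type v) [AddCommGroup M] [Module ℂ M] [Module ℂ[G] M]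
    [IsScalarTower ℂ ℂ[G] M] [IsSimpleModule ℂ[G] M] :
    (Representation.ofModule' (k := ℂ) (G := G) M).IsIrreducible := by
  let i : Subrepresentation (Representation.ofModule' (k := ℂ) (G := G) M) ≃o
      Submodule ℂ[G] M :=
    { toFun := fun U => { U.toSubmodule with
        smul_mem' := fun a v hv => by
          induction a using MonoidAlgebra.induction_on with
          | of g => exact U.apply_mem_toSubmodule g hv
          | add a b ha hb => rw [add_smul]; exact U.toSubmodule.add_mem ha hb
          | smul c a ha => rw [smul_assoc]; exact U.toSubmodule.smul_mem c ha }
      invFun := fun N => ⟨N.restrictScalars ℂ, fun g v hv =>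
        N.smul_mem (MonoidAlgebra.of ℂ G g) hv⟩
      left_inv := fun _ => rfl
      right_inv := fun _ => rfl
      map_rel_iff' := Iff.rfl }
  exact (OrderIso.isSimpleOrder_iff i).2 ((isSimpleModule_iff _ _).1 inferInstance)

/-- A function on a finite group that acts as zero in every irreducible representation vanishes. -/
theorem eq_zero_of_forall_irrRep [Fintype G] (f : G → ℂ)
    (h : ∀ A : IrrRep G, ∑ g, f g • A.ρ g = 0) : f = 0 := by
  set a : ℂ[G] := ∑ g, MonoidAlgebra.single g (f g) with ha
  -- For a maximal left ideal `m` the quotient `ℂ[G] ⧸ m` is irreducible, so `a` kills the class of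
  -- `1`, that is, `a ∈ m`. By Maschke the intersection of all `m` is zero.
  have hmem : a ∈ Ring.jacobson ℂ[G] := by
    rw [Ring.jacobson, Module.jacobson, Submodule.mem_sInf]
    intro m hm
    have hs : IsSimpleModule ℂ[G] (ℂ[G] ⧸ m) := isSimpleModule_iff_isCoatom.2 hm
    have : Module.Finite ℂ (ℂ[G] ⧸ m) := Module.Finite.trans ℂ[G] _
    set σ := Representation.ofModule' (k := ℂ) (G := G) (ℂ[G] ⧸ m) with hσ
    -- `IrrRep` asks for a space in `Type`, whereas the quotient lives in the universe of `G`;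
    -- coordinates move it there.
    let e := (Module.finBasis ℂ (ℂ[G] ⧸ m)).equivFun
    have h0 := LinearMap.congr_fun
      (h ⟨_, transport σ e, transport_isIrreducible (ofModule'_isIrreducible _) e⟩)
      (e (Submodule.Quotient.mk 1))
    have h1 : ∀ g, σ g (Submodule.Quotient.mk 1) =
        Submodule.Quotient.mk (MonoidAlgebra.single g (1 : ℂ)) := fun g => by
      rw [← mul_one (MonoidAlgebra.single g (1 : ℂ))]
      rfl
    have h2 : e (Submodule.Quotient.mk a) = 0 := by
      refine Eq.trans ?_ h0
      rw [ha]
      simp only [LinearMap.sum_apply, LinearMap.smul_apply, transport_apply,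
        e.symm_apply_apply, h1]
      simp only [← map_smul, ← map_sum, ← Submodule.Quotient.mk_smul,
        MonoidAlgebra.smul_single, smul_eq_mul, mul_one]
      exact congrArg e (map_sum m.mkQ _ _)
    exact (Submodule.Quotient.mk_eq_zero m).1 (e.map_eq_zero_iff.1 h2)
  rw [IsSemisimpleRing.jacobson_eq_bot, Submodule.mem_bot] at hmem
  ext g
  have h' := congrArg (fun x : ℂ[G] => x.coeff g) hmem
  classical
  simpa [ha, Finsupp.single_apply] using h'

end Maschke

end RepresentationTheory

/-! ### The fibers of the extension over `Q`. -/

section Fiber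

variable {G : Type u} {H : Type v} {Q : Type w} [Group G] [Group H] [Group Q]
  {S : GroupExtension G H Q} {s : S.Section}

theorem exists_inl_mul_section (s : S.Section) (h : H) :
    ∃ g : G, S.inl g * s (S.rightHom h) = h := by
  obtain ⟨g, hg⟩ : h * (s (S.rightHom h))⁻¹ ∈ S.inl.range := by
    rw [S.range_inl_eq_ker_rightHom, MonoidHom.mem_ker, map_mul, map_inv,
      GroupExtension.Section.rightHom_section, mul_inv_cancel]
  exact ⟨g, by rw [hg, inv_mul_cancel_right]⟩

/-- The component in `G` of an element of `H`, with respect to the section `s`. -/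
noncomputable def kerPart (s : S.Section) (h : H) : G := (exists_inl_mul_section s h).choose

theorem inl_kerPart_mul (s : S.Section) (h : H) :
    S.inl (kerPart s h) * s (S.rightHom h) = h := (exists_inl_mul_section s h).choose_spec

theorem rightHom_inl_mul_section (s : S.Section) (g : G) (q : Q) :
    S.rightHom (S.inl g * s q) = q := by
  rw [map_mul, S.rightHom_inl, one_mul, GroupExtension.Section.rightHom_section]

theorem kerPart_inl_mul_section (s : S.Section) (g : G) (q : Q) :
    kerPart s (S.inl g * s q) = g := by
  have h := inl_kerPart_mul s (S.inl g * s q)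
  rw [rightHom_inl_mul_section] at h
  exact S.inl_injective (mul_right_cancel h)

/-- The elements of `H` over `q` are parametrized by `G`. -/
noncomputable def fiberEquiv (s : S.Section) (q : Q) : G ≃ {h : H // S.rightHom h = q} where
  toFun g := ⟨S.inl g * s q, rightHom_inl_mul_section s g q⟩
  invFun h := kerPart s h.1
  left_inv g := kerPart_inl_mul_section s g q
  right_inv h := Subtype.ext (by
    obtain ⟨h, rfl⟩ := h
    exact inl_kerPart_mul s h)

theorem finite_of_extension (s : S.Section) [Finite G] [Finite Q] : Finite H :=
  Finite.of_injective (fun h : H => (kerPart s h, S.rightHom h)) fun a b hab => by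
    rw [← inl_kerPart_mul s a, ← inl_kerPart_mul s b, (Prod.mk.inj hab).1, (Prod.mk.inj hab).2]

theorem sum_fiber [Fintype G] [Fintype H] (s : S.Section) (q : Q) (u : H → ℂ)
    (hu : ∀ h, S.rightHom h ≠ q → u h = 0) : ∑ h, u h = ∑ g, u (S.inl g * s q) := by
  classical
  rw [← Finset.sum_filter_of_ne (p := fun h => S.rightHom h = q)
    (fun h _ hne => by_contra fun hq => hne (hu h hq)),
    ← Finset.sum_subtype_eq_sum_filter, Finset.subtype_univ]
  exact (Fintype.sum_equiv (fiberEquiv s q) _ _ fun _ => rfl).symm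

end Fiber

/-- The action of a group element as a linear equivalence. -/
def repEquiv {G : Type u} [Group G] {V : Type v} [AddCommGroup V] [Module ℂ V]
    (ρ : Representation ℂ G V) (g : G) : V ≃ₗ[ℂ] V :=
  LinearEquiv.ofLinearMap (ρ g) (ρ g⁻¹)
    (by rw [← Module.End.mul_eq_comp, ← map_mul, mul_inv_cancel, map_one]; rfl)
    (by rw [← Module.End.mul_eq_comp, ← map_mul, inv_mul_cancel, map_one]; rfl)

/-! ### Arrows and loops indexed by `H`, and their traces. -/

namespace Choices

variable {G : Type u} {H : Type v} {Q : Type w} [Group G] [Group H] [Group Q]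
  {S : GroupExtension G H Q} {s : S.Section} (D : Choices s)

theorem rep_mul_apply (x : Dual G) (g k : G) (a : D.V x) :
    D.rep x (g * k) a = D.rep x g (D.rep x k a) := by rw [map_mul]; rfl

theorem not_nonempty_equiv {x y : Dual G} (h : x ≠ y) :
    ¬ Nonempty ((D.rep x).Equiv (D.rep y)) := fun he =>
  h (by rw [← D.mk_rep x, ← D.mk_rep y]; exact Quotient.sound he)

/-- The map `T_{j(h)} ρ(g)⁻¹ : V x → V y` for `h = g s(j(h))`. It extends the `T_q` to `H`. -/
noncomputable def arrow (x y : Dual G) (h : H) (e : act s (S.rightHom h) x = y) :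
    D.V x ≃ₗ[ℂ] D.V y :=
  (repEquiv (D.rep x) (kerPart s h)⁻¹).trans (D.T (S.rightHom h) x y e).toLinearEquiv

theorem arrow_apply (x y : Dual G) (h : H) (e : act s (S.rightHom h) x = y) (a : D.V x) :
    D.arrow x y h e a = D.T (S.rightHom h) x y e (D.rep x (kerPart s h)⁻¹ a) := rfl

theorem arrow_apply_of_eq (x y : Dual G) {h : H} (e : act s (S.rightHom h) x = y) {g : G} {q : Q}
    (hg : S.inl g * s q = h) (e' : act s q x = y) (a : D.V x) :
    D.arrow x y h e a = D.T q x y e' (D.rep x g⁻¹ a) := by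
  obtain rfl : S.rightHom h = q := by rw [← hg, rightHom_inl_mul_section]
  obtain rfl : kerPart s h = g :=
    S.inl_injective (mul_right_cancel ((inl_kerPart_mul s h).trans hg.symm))
  rfl

/-- Intertwining moves the `G`-component of `h₂` past `T`; the factor `ρ(τ)⁻¹` in the definition of
`c` then completes the `G`-component of `h₁ * h₂`, and only the scalar `c` remains. -/
theorem arrow_mul_apply (x y z : Dual G) (h₁ h₂ : H) (e₁ : act s (S.rightHom h₁) x = y)
    (e₂ : act s (S.rightHom h₂) y = z) (e : act s (S.rightHom (h₁ * h₂)) x = z) (a : D.V x) :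
    D.arrow y z h₂ e₂ (D.arrow x y h₁ e₁ a) =
      (D.c x (S.rightHom h₁) (S.rightHom h₂) : ℂ) • D.arrow x z (h₁ * h₂) e a := by
  subst e₁
  subst e₂
  set g₁ := kerPart s h₁ with hg₁
  set g₂ := kerPart s h₂ with hg₂
  have key : S.inl (g₁ * S.conjAct (s (S.rightHom h₁)) g₂ *
      tau s (S.rightHom h₁) (S.rightHom h₂)) * s (S.rightHom h₁ * S.rightHom h₂) = h₁ * h₂ := by
    conv_rhs => rw [← inl_kerPart_mul s h₁, ← inl_kerPart_mul s h₂, ← hg₁, ← hg₂]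
    rw [map_mul, map_mul, inl_tau, S.inl_conjAct_comm]
    group
  rw [D.arrow_apply_of_eq x _ e key (act_mul s _ _ x), D.arrow_apply, D.arrow_apply, ← D.T_rep,
    D.c_spec, ← D.rep_mul_apply, ← D.rep_mul_apply, ← hg₁, ← hg₂]
  congr 4
  rw [map_inv]
  group

/-- Conjugation in `H` multiplies the loops `V x → V x` over `q` by `γ`. -/
theorem arrow_conj_apply (x y : Dual G) (h k : H) (hk : S.rightHom k * S.rightHom h =
      S.rightHom h * S.rightHom k) (ex : act s (S.rightHom h) x = x)
    (ey : act s (S.rightHom (k⁻¹ * h * k)) y = y) (e : act s (S.rightHom k) x = y) (a : D.V x) :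
    D.arrow y y (k⁻¹ * h * k) ey (D.arrow x y k e a) =
      (D.gamma x (S.rightHom k) (S.rightHom h) : ℂ) • D.arrow x y k e (D.arrow x x h ex a) := by
  have hj : S.rightHom (k⁻¹ * h * k) = S.rightHom h := by
    rw [map_mul, map_mul, map_inv, mul_assoc, ← hk, inv_mul_cancel_left]
  have e₁ : act s (S.rightHom (h * k)) x = y := by rw [map_mul, act_mul, ex, e]
  have e₂ : act s (S.rightHom (k * (k⁻¹ * h * k))) x = y := by rw [map_mul, act_mul, e, ey]
  have heq : D.arrow x y _ e₂ a = D.arrow x y _ e₁ a := by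
    congr 2
    group
  -- Both composites are multiples of the arrow of `h * k = k * (k⁻¹ * h * k)`; `γ` is the ratio of
  -- the two values of `c`.
  rw [D.arrow_mul_apply x y y k _ e ey e₂, D.arrow_mul_apply x x y h k ex e e₁, smul_smul, heq, hj,
    ← Circle.coe_mul, gamma, inv_mul_cancel_right]

open Classical in
/-- The trace of the loop at `x` given by an element of `H` over `q`. -/
noncomputable def chi (q : Q) (x : Dual G) (h : H) : ℂ :=
  if e : S.rightHom h = q ∧ act s (S.rightHom h) x = x then
    LinearMap.trace ℂ (D.V x) (D.arrow x x h e.2).toLinearMap else 0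

open Classical in
/-- The trace of the inverse of the loop at `x` given by an element of `H` over `q`. -/
noncomputable def chiInv (q : Q) (x : Dual G) (h : H) : ℂ :=
  if e : S.rightHom h = q ∧ act s (S.rightHom h) x = x then
    LinearMap.trace ℂ (D.V x) (D.arrow x x h e.2).symm.toLinearMap else 0

theorem chi_eq_zero {q : Q} {x : Dual G} {h : H} (hq : S.rightHom h ≠ q) : D.chi q x h = 0 :=
  dif_neg fun e => hq e.1

theorem chiInv_eq_zero {q : Q} {x : Dual G} {h : H} (hq : S.rightHom h ≠ q) :
    D.chiInv q x h = 0 :=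
  dif_neg fun e => hq e.1

theorem chi_eq_trace {q : Q} {x : Dual G} (hx : act s q x = x) {h : H} (hq : S.rightHom h = q) :
    D.chi q x h = LinearMap.trace ℂ (D.V x) (D.arrow x x h (hq ▸ hx)).toLinearMap :=
  dif_pos ⟨hq, hq ▸ hx⟩

theorem chiInv_eq_trace {q : Q} {x : Dual G} (hx : act s q x = x) {h : H}
    (hq : S.rightHom h = q) :
    D.chiInv q x h = LinearMap.trace ℂ (D.V x) (D.arrow x x h (hq ▸ hx)).symm.toLinearMap :=
  dif_pos ⟨hq, hq ▸ hx⟩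

theorem act_act_of_commute {q p : Q} {x : Dual G} (hx : act s q x = x) (hp : p * q = q * p) :
    act s q (act s p x) = act s p x := by
  rw [← act_mul, hp, act_mul, hx]

theorem rightHom_conj_eq {q : Q} {k : H} (hk : S.rightHom k * q = q * S.rightHom k) (h : H) :
    S.rightHom (k⁻¹ * h * k) = q ↔ S.rightHom h = q := by
  rw [map_mul, map_mul, map_inv, mul_assoc, inv_mul_eq_iff_eq_mul, hk, mul_left_inj]

/-- The trace is unchanged under conjugation by the arrow of `k`, so only the scalar of
`arrow_conj_apply` survives. -/
theorem chi_conj {q : Q} {x : Dual G} (hx : act s q x = x) {k : H}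
    (hk : S.rightHom k * q = q * S.rightHom k) (h : H) :
    D.chi q (act s (S.rightHom k) x) (k⁻¹ * h * k) =
      D.gamma x (S.rightHom k) q * D.chi q x h := by
  by_cases hq : S.rightHom h = q
  · subst hq
    have hq' := (rightHom_conj_eq hk h).2 rfl
    have hy := act_act_of_commute hx hk
    rw [D.chi_eq_trace hx rfl, D.chi_eq_trace hy hq',
      ← LinearMap.trace_conj' (D.arrow x x h hx).toLinearMap
        (D.arrow x (act s (S.rightHom k) x) k rfl)]
    refine Eq.trans (congrArg _ ?_) ((LinearMap.trace ℂ _).map_smul _ _)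
    ext b
    obtain ⟨a, rfl⟩ := (D.arrow x (act s (S.rightHom k) x) k rfl).surjective b
    simpa using D.arrow_conj_apply x _ h k hk hx (hq'.symm ▸ hy) rfl a
  · rw [D.chi_eq_zero hq, D.chi_eq_zero fun h' => hq ((rightHom_conj_eq hk h).1 h'), mul_zero]

theorem chiInv_conj {q : Q} {x : Dual G} (hx : act s q x = x) {k : H}
    (hk : S.rightHom k * q = q * S.rightHom k) (h : H) :
    D.chiInv q (act s (S.rightHom k) x) (k⁻¹ * h * k) =
      (D.gamma x (S.rightHom k) q : ℂ)⁻¹ * D.chiInv q x h := by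
  by_cases hq : S.rightHom h = q
  · subst hq
    have hq' := (rightHom_conj_eq hk h).2 rfl
    have hy := act_act_of_commute hx hk
    rw [D.chiInv_eq_trace hx rfl, D.chiInv_eq_trace hy hq',
      ← LinearMap.trace_conj' (D.arrow x x h hx).symm.toLinearMap
        (D.arrow x (act s (S.rightHom k) x) k rfl)]
    refine Eq.trans (congrArg _ ?_) ((LinearMap.trace ℂ _).map_smul _ _)
    ext b
    obtain ⟨a, rfl⟩ := (D.arrow x (act s (S.rightHom k) x) k rfl).surjective b
    obtain ⟨a, rfl⟩ := (D.arrow x x h hx).surjective a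
    have := D.arrow_conj_apply x _ h k hk hx (hq'.symm ▸ hy) rfl a
    rw [← inv_smul_eq_iff₀ (Circle.coe_ne_zero _)] at this
    simp only [LinearEquiv.coe_coe, LinearMap.smul_apply, LinearEquiv.conj_apply_apply,
      LinearEquiv.symm_apply_apply]
    rw [← this, map_smul, LinearEquiv.symm_apply_apply]
  · rw [D.chiInv_eq_zero hq, D.chiInv_eq_zero fun h' => hq ((rightHom_conj_eq hk h).1 h'),
      mul_zero]

theorem chi_inl_mul {q : Q} {x : Dual G} (hx : act s q x = x) (g : G) :
    D.chi q x (S.inl g * s q) = LinearMap.trace ℂ (D.V x)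
      ((D.T q x x hx).toLinearEquiv.toLinearMap ∘ₗ D.rep x g⁻¹) := by
  rw [D.chi_eq_trace hx (rightHom_inl_mul_section s g q)]
  congr 1
  ext a
  exact D.arrow_apply_of_eq x x _ rfl hx a

theorem chiInv_inl_mul {q : Q} {x : Dual G} (hx : act s q x = x) (g : G) :
    D.chiInv q x (S.inl g * s q) = LinearMap.trace ℂ (D.V x)
      (D.rep x g ∘ₗ (D.T q x x hx).symm.toLinearEquiv.toLinearMap) := by
  rw [D.chiInv_eq_trace hx (rightHom_inl_mul_section s g q)]
  congr 1
  ext a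
  apply (D.arrow x x _ _).injective
  rw [LinearEquiv.coe_coe, LinearEquiv.apply_symm_apply, D.arrow_apply_of_eq x x _ rfl hx,
    LinearMap.comp_apply, ← D.rep_mul_apply, inv_mul_cancel, map_one]
  exact ((D.T q x x hx).apply_symm_apply a).symm

/-- Orthogonality of the traces of the loops over `q`. -/
theorem sum_chiInv_mul_chi_eq_zero [Fintype G] [Fintype H] {q : Q} {x y : Dual G}
    (hx : act s q x = x) (hy : act s q y = y) (hxy : x ≠ y) :
    ∑ h, D.chiInv q x h * D.chi q y h = 0 := by
  rw [sum_fiber s q _ fun h hq => by rw [D.chi_eq_zero hq, mul_zero]]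
  simp_rw [D.chiInv_inl_mul hx, D.chi_inl_mul hy]
  exact sum_trace_mul_trace_eq_zero (D.irr x) (D.irr y) (D.not_nonempty_equiv hxy.symm) _ _

/-- The inserted operators are `T_q` and its inverse; the trace of their product is the dimension,
which cancels the denominator. -/
theorem sum_chiInv_mul_chi_self [Fintype G] [Fintype H] {q : Q} {x : Dual G}
    (hx : act s q x = x) : ∑ h, D.chiInv q x h * D.chi q x h = Fintype.card G := by
  rw [sum_fiber s q _ fun h hq => by rw [D.chi_eq_zero hq, mul_zero]]
  simp_rw [D.chiInv_inl_mul hx, D.chi_inl_mul hx]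
  rw [sum_trace_mul_trace_self (D.irr x), show (D.T q x x hx).toLinearEquiv.toLinearMap ∘ₗ
    (D.T q x x hx).symm.toLinearEquiv.toLinearMap = 1 from
      LinearMap.ext (D.T q x x hx).apply_symm_apply, LinearMap.trace_one,
    mul_div_cancel_right₀ _ (finrank_ne_zero_of_isIrreducible (D.irr x))]

/-! ### Completeness of the loop traces among class functions. -/

section Completeness

variable [Fintype G] [Fintype H]

/-- The operator attached to a class function on `H` and to `q` vanishes in `rep x`. -/
theorem sum_smul_rep_eq_zero {q : Q} {F : H → ℂ} (hF : ∀ h k, F (k⁻¹ * h * k) = F h)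
    (h0 : ∀ x, act s q x = x → ∑ h, F h * D.chi q x h = 0) (x : Dual G) :
    ∑ g, F (S.inl g * s q) • D.rep x g⁻¹ = 0 := by
  set B : D.V x →ₗ[ℂ] D.V x := ∑ g, F (S.inl g * s q) • D.rep x g⁻¹ with hB
  have hBa : ∀ a, B a = ∑ g, F (S.inl g * s q) • D.rep x g⁻¹ a := fun a => by
    simp [hB, LinearMap.sum_apply]
  -- Conjugating `g s(q)` by `k` replaces `g` by `k⁻¹ g (s(q) k s(q)⁻¹)`, so invariance of `F` makes
  -- `B` twisted-equivariant and `T_q B` an intertwiner `rep x → rep y`.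
  have hcomm : ∀ k a, B (D.rep x k a) = D.rep x (S.conjAct (s q) k) (B a) := fun k a => by
    rw [hBa, hBa, map_sum]
    refine Fintype.sum_equiv ((Equiv.mulLeft k⁻¹).trans (Equiv.mulRight (S.conjAct (s q) k)))
      _ _ fun g => ?_
    have hg : S.inl (k⁻¹ * g * S.conjAct (s q) k) * s q =
        (S.inl k)⁻¹ * (S.inl g * s q) * S.inl k := by
      rw [map_mul, map_mul, map_inv, S.inl_conjAct_comm]
      group
    simp only [Equiv.trans_apply, Equiv.coe_mulLeft, Equiv.coe_mulRight, map_smul]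
    rw [hg, hF, ← D.rep_mul_apply, ← D.rep_mul_apply]
    congr 3
    group
  have hT : ∀ y (e : act s q x = y), (D.T q x y e).toLinearEquiv.toLinearMap ∘ₗ B = 0 → B = 0 :=
    fun y e h => by
      ext a
      exact (D.T q x y e).map_eq_zero_iff.1 (LinearMap.congr_fun h a)
  have hI : ∀ y (e : act s q x = y) k a, ((D.T q x y e).toLinearEquiv.toLinearMap ∘ₗ B)
      (D.rep x k a) = D.rep y k (((D.T q x y e).toLinearEquiv.toLinearMap ∘ₗ B) a) :=
    fun y e k a => by
      rw [LinearMap.comp_apply, hcomm]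
      exact D.T_rep q x y e k (B a)
  by_cases hx : act s q x = x
  · refine hT x hx ?_
    -- The trace of the scalar `T_q B` is the pairing of `F` with `chi`, which is zero by `h0`.
    obtain ⟨c, hc⟩ := exists_eq_smul_one_of_commute (D.irr x) _ (hI x hx)
    have htr := h0 x hx
    rw [sum_fiber s q _ fun h hq => by rw [D.chi_eq_zero hq, mul_zero]] at htr
    have hsum : (D.T q x x hx).toLinearEquiv.toLinearMap ∘ₗ B = ∑ g, F (S.inl g * s q) •
        ((D.T q x x hx).toLinearEquiv.toLinearMap ∘ₗ D.rep x g⁻¹) := LinearMap.ext fun a => by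
      simp [hBa, map_sum, LinearMap.sum_apply]
    have htr' := congrArg (LinearMap.trace ℂ (D.V x)) hsum
    simp only [map_sum, map_smul, ← D.chi_inl_mul hx, smul_eq_mul] at htr'
    rw [htr, hc, map_smul, LinearMap.trace_one, smul_eq_mul] at htr'
    rw [hc, (mul_eq_zero.1 htr').resolve_right (finrank_ne_zero_of_isIrreducible (D.irr x)),
      zero_smul]
  · exact hT _ rfl (eq_zero_of_intertwining (D.irr x) (D.irr _)
      (D.not_nonempty_equiv (Ne.symm hx)) _ (hI _ rfl))

/-- A class function orthogonal to all traces of loops over `q` vanishes over `q`. -/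
theorem eq_zero_of_sum_mul_chi_eq_zero {q : Q} {F : H → ℂ} (hF : ∀ h k, F (k⁻¹ * h * k) = F h)
    (h0 : ∀ x, act s q x = x → ∑ h, F h * D.chi q x h = 0) {h : H} (hq : S.rightHom h = q) :
    F h = 0 := by
  -- The inverse matches the `D.rep x g⁻¹` in the operator just shown to vanish.
  have key : (fun g => F (S.inl g⁻¹ * s q)) = 0 := eq_zero_of_forall_irrRep _ fun A => by
    let x : Dual G := Quotient.mk (irrSetoid G) A
    obtain ⟨e⟩ : Nonempty (A.ρ.Equiv (D.rep x)) := Quotient.exact (D.mk_rep x).symm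
    have hx := D.sum_smul_rep_eq_zero hF h0 x
    rw [← Equiv.sum_comp (Equiv.inv G)] at hx
    ext a
    apply e.toLinearEquiv.injective
    have := LinearMap.congr_fun hx (e a)
    simp only [Equiv.inv_apply, inv_inv, LinearMap.sum_apply, LinearMap.smul_apply,
      LinearMap.zero_apply] at this
    simp only [LinearMap.sum_apply, LinearMap.smul_apply, LinearMap.zero_apply, map_sum, map_smul,
      map_zero]
    rw [← this]
    exact Finset.sum_congr rfl fun g _ => congrArg _
      (Representation.IntertwiningMap.isIntertwining _ _ e.toIntertwiningMap g a)
  have := congrFun key (kerPart s h)⁻¹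
  subst hq
  simpa only [Pi.zero_apply, inv_inv, inl_kerPart_mul] using this

end Completeness

end Choices

/-- Two finite sets have the same size if an injective linear map between their function spaces
admits a diagonal family of values. -/
theorem card_eq_of_diagonal {α β : Type*} [Finite α] (L : (α → ℂ) →ₗ[ℂ] (β → ℂ))
    (hL : ∀ f, L f = 0 → f = 0) (φ : β → α → ℂ) (hne : ∀ b, L (φ b) b ≠ 0)
    (h0 : ∀ b b', b ≠ b' → L (φ b) b' = 0) : Nat.card α = Nat.card β := by
  classical
  have := Fintype.ofFinite α
  have hli : LinearIndependent ℂ φ := by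
    rw [linearIndependent_iff']
    intro t c hc i hi
    have h := congrFun (congrArg L hc) i
    rw [map_sum, Finset.sum_apply, Finset.sum_eq_single i
      (fun j _ hj => by rw [map_smul, Pi.smul_apply, h0 j i hj, smul_zero])
      (fun hni => absurd hi hni), map_smul, map_zero, Pi.smul_apply, Pi.zero_apply] at h
    exact (smul_eq_zero.1 h).resolve_right (hne i)
  -- Finiteness of `β` comes from independence of `φ` in a finite-dimensional space.
  have := hli.finite
  have := Fintype.ofFinite β
  rw [Nat.card_eq_fintype_card, Nat.card_eq_fintype_card]
  refine le_antisymm ?_ ?_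
  · simpa using LinearMap.finrank_le_finrank_of_injective (f := L)
      ((injective_iff_map_eq_zero L).2 hL)
  · simpa using hli.fintype_card_le_finrank

/-- An element of `Q` conjugating `j h` to `q` lifts to `H`, so class functions over `⟨q⟩` are
determined on the fiber over `q`. -/
theorem exists_eq_mk_of_map_eq {H Q : Type*} [Group H] [Group Q] {j : H →* Q}
    (hj : Function.Surjective j) {q : Q} {C : ConjClasses H}
    (hC : ConjClasses.map j C = ConjClasses.mk q) : ∃ h, j h = q ∧ ConjClasses.mk h = C := by
  induction C using Quotient.inductionOn with
  | h h =>
    obtain ⟨p, hp⟩ := isConj_iff.1 (ConjClasses.mk_eq_mk_iff_isConj.1 hC)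
    obtain ⟨k, rfl⟩ := hj p
    exact ⟨k * h * k⁻¹, by rw [map_mul, map_mul, map_inv, hp],
      ConjClasses.mk_eq_mk_iff_isConj.2 (isConj_iff.2 ⟨k, rfl⟩).symm⟩

/-! ### Orbits of the centralizer. -/

section Orbits

variable {G : Type u} {H : Type v} {Q : Type w} [Group G] [Group H] [Group Q]
  {S : GroupExtension G H Q} {s : S.Section}

theorem orbit_act {q p : Q} (hp : p ∈ Subgroup.centralizer {q}) (x : Dual G) :
    orbit s q (act s p x) = orbit s q x := by
  ext y
  constructor
  · rintro ⟨r, hr, rfl⟩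
    exact ⟨p * r, mul_mem hp hr, act_mul s p r x⟩
  · rintro ⟨r, hr, rfl⟩
    exact ⟨p⁻¹ * r, mul_mem (inv_mem hp) hr, by rw [← act_mul, mul_inv_cancel_left]⟩

theorem orbit_eq_of_mem {q : Q} {x : Dual G} {O : Set (Dual G)} (hO : O ∈ orbits s q)
    (hx : x ∈ O) : orbit s q x = O := by
  obtain ⟨y, -, rfl⟩ := hO
  obtain ⟨p, hp, rfl⟩ := hx
  exact orbit_act hp y

theorem commute_of_mem_centralizer {q p : Q} (hp : p ∈ Subgroup.centralizer {q}) :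
    p * q = q * p := (Subgroup.mem_centralizer_singleton_iff.1 hp)

theorem act_eq_of_mem_orbits {q : Q} {x : Dual G} {O : Set (Dual G)} (hO : O ∈ orbits s q)
    (hx : x ∈ O) : act s q x = x := by
  obtain ⟨y, hy, rfl⟩ := hO
  obtain ⟨p, hp, rfl⟩ := hx
  exact Choices.act_act_of_commute hy (commute_of_mem_centralizer hp)

end Orbits

namespace Choices

variable {G : Type u} {H : Type v} {Q : Type w} [Group G] [Group H] [Group Q]
  {S : GroupExtension G H Q} {s : S.Section} (D : Choices s)

/-! ### Pairings of class functions with loop traces. -/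

section Sums

variable [Fintype H]

/-- Substitute a conjugate of `h` by `s p`: `F` is invariant and `chi` picks up `γ`. When `p` fixes
`x` and `γ ≠ 1`, this forces the pairing to vanish. -/
theorem sum_mul_chi_act {q : Q} {F : H → ℂ} (hF : ∀ h k, F (k⁻¹ * h * k) = F h) {x : Dual G}
    (hx : act s q x = x) {p : Q} (hp : p ∈ Subgroup.centralizer {q}) :
    ∑ h, F h * D.chi q (act s p x) h = D.gamma x p q * ∑ h, F h * D.chi q x h := by
  have hp' : S.rightHom (s p) = p := GroupExtension.Section.rightHom_section s p
  have hc := commute_of_mem_centralizer hp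
  rw [Finset.mul_sum, ← Equiv.sum_comp (MulAut.conj (s p)⁻¹).toEquiv]
  refine Finset.sum_congr rfl fun h _ => ?_
  have := D.chi_conj hx (k := s p) (by rwa [hp']) h
  rw [hp'] at this
  simp only [MulEquiv.toEquiv_eq_coe, EquivLike.coe_coe, MulAut.conj_apply, inv_inv, hF, this]
  ring

/-- The class function on `H` obtained by summing the conjugates of `chiInv`. -/
noncomputable def classSum (q : Q) (x : Dual G) (h : H) : ℂ := ∑ k, D.chiInv q x (k⁻¹ * h * k)

theorem classSum_conj (q : Q) (x : Dual G) (h k : H) :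
    D.classSum q x (k⁻¹ * h * k) = D.classSum q x h := by
  refine Fintype.sum_equiv (Equiv.mulLeft k) _ _ fun l => ?_
  rw [Equiv.coe_mulLeft]
  congr 1
  group

/-- If `k` lies over `C(q)`, the first factor is a multiple of `chiInv` at a class other than `y`,
and orthogonality applies; otherwise the two factors have disjoint supports. -/
theorem sum_chiInv_conj_mul_chi_eq_zero [Fintype G] {q : Q} {x y : Dual G}
    (hx : act s q x = x) (hy : act s q y = y) (k : H)
    (hxy : S.rightHom k ∈ Subgroup.centralizer {q} → act s (S.rightHom k) y ≠ x) :
    ∑ h, D.chiInv q x (k⁻¹ * h * k) * D.chi q y h = 0 := by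
  by_cases hk : S.rightHom k ∈ Subgroup.centralizer {q}
  · obtain ⟨z, hz, rfl⟩ : ∃ z, act s q z = z ∧ act s (S.rightHom k) z = x :=
      ⟨act s (S.rightHom k)⁻¹ x,
        act_act_of_commute hx (commute_of_mem_centralizer (inv_mem hk)),
        by rw [← act_mul, inv_mul_cancel, act_one]⟩
    simp_rw [D.chiInv_conj hz (commute_of_mem_centralizer hk), mul_assoc]
    rw [← Finset.mul_sum, D.sum_chiInv_mul_chi_eq_zero hz hy, mul_zero]
    rintro rfl
    exact hxy hk rfl
  · refine Finset.sum_eq_zero fun h _ => ?_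
    by_cases hq : S.rightHom h = q
    · rw [D.chiInv_eq_zero, zero_mul]
      intro h'
      apply hk
      rw [map_mul, map_mul, map_inv, hq, mul_assoc, inv_mul_eq_iff_eq_mul] at h'
      exact Subgroup.mem_centralizer_singleton_iff.2 h'.symm
    · rw [D.chi_eq_zero hq, mul_zero]

theorem sum_chiInv_conj_mul_chi_self [Fintype G] {q : Q} {x : Dual G} (hx : act s q x = x) {k : H}
    (hk : S.rightHom k ∈ stab s q x) (hγ : D.gamma x (S.rightHom k) q = 1) :
    ∑ h, D.chiInv q x (k⁻¹ * h * k) * D.chi q x h = Fintype.card G := by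
  rw [← D.sum_chiInv_mul_chi_self hx]
  refine Finset.sum_congr rfl fun h _ => ?_
  have := D.chiInv_conj hx (commute_of_mem_centralizer hk.1) h
  rw [hk.2, hγ, Circle.coe_one, inv_one, one_mul] at this
  rw [this]

theorem sum_classSum_mul_chi (q : Q) (x y : Dual G) :
    ∑ h, D.classSum q x h * D.chi q y h =
      ∑ k, ∑ h, D.chiInv q x (k⁻¹ * h * k) * D.chi q y h := by
  simp_rw [classSum, Finset.sum_mul]
  exact Finset.sum_comm

/-- Each `k` over the stabilizer contributes `|G|` and every other `k` zero, so nothing cancels; `k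
= 1` contributes. -/
theorem sum_classSum_mul_chi_self_ne_zero [Fintype G] {q : Q} {x : Dual G} (hx : act s q x = x)
    (hγ : ∀ p ∈ stab s q x, D.gamma x p q = 1) :
    ∑ h, D.classSum q x h * D.chi q x h ≠ 0 := by
  classical
  rw [sum_classSum_mul_chi]
  have : ∀ k : H, ∑ h, D.chiInv q x (k⁻¹ * h * k) * D.chi q x h =
      if S.rightHom k ∈ stab s q x then (Fintype.card G : ℂ) else 0 := fun k => by
    split_ifs with hk
    · exact D.sum_chiInv_conj_mul_chi_self hx hk (hγ _ hk)
    · exact D.sum_chiInv_conj_mul_chi_eq_zero hx hx k fun h h' => hk ⟨h, h'⟩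
  simp_rw [this]
  rw [Finset.sum_ite, Finset.sum_const_zero, add_zero, Finset.sum_const, nsmul_eq_mul]
  refine mul_ne_zero (Nat.cast_ne_zero.2 (Finset.card_ne_zero_of_mem (a := 1) ?_))
    (Nat.cast_ne_zero.2 Fintype.card_ne_zero)
  rw [Finset.mem_filter, map_one]
  exact ⟨Finset.mem_univ _, one_mem _, act_one s x⟩

end Sums

/-- The extension by zero of a function on the conjugacy classes over that of `q`, viewed as
a function on `H`. -/
noncomputable def extend (q : Q) :
    ({C : ConjClasses H // ConjClasses.map S.rightHom C = ConjClasses.mk q} → ℂ) →ₗ[ℂ] (H → ℂ) :=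
  LinearMap.funLeft ℂ ℂ ConjClasses.mk ∘ₗ Function.ExtendByZero.linearMap ℂ Subtype.val

theorem extend_apply {q : Q} {h : H} (hq : S.rightHom h = q)
    (f : {C : ConjClasses H // ConjClasses.map S.rightHom C = ConjClasses.mk q} → ℂ) :
    extend q f h = f ⟨ConjClasses.mk h, congrArg ConjClasses.mk hq⟩ :=
  Subtype.val_injective.extend_apply f 0 ⟨ConjClasses.mk h, congrArg ConjClasses.mk hq⟩

theorem extend_conj (q : Q)
    (f : {C : ConjClasses H // ConjClasses.map S.rightHom C = ConjClasses.mk q} → ℂ) (h k : H) :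
    extend q f (k⁻¹ * h * k) = extend q f h := by
  refine congrArg (Function.extend Subtype.val f 0) (ConjClasses.mk_eq_mk_iff_isConj.2 ?_)
  exact isConj_iff.2 ⟨k, by group⟩

end Choices

end ExtensionDual

/-! ### The count of conjugacy classes over `⟨q⟩`. -/

open ExtensionDual in
theorem mainTheorem1 {G : Type u} {H : Type v} {Q : Type w} [Group G] [Group H] [Group Q]
    [Finite G] [Finite Q] (S : GroupExtension G H Q) (s : S.Section) (hs : s 1 = 1)
    (D : ExtensionDual.Choices s) (q : Q) :
    Nat.card {C : ConjClasses H // ConjClasses.map S.rightHom C = ConjClasses.mk q} =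
      Nat.card {O : Set (ExtensionDual.Dual G) // O ∈ ExtensionDual.orbits s q ∧
        ∃ x ∈ O, ∀ q₁ ∈ ExtensionDual.stab s q x, D.gamma x q₁ q = 1} := by
  classical
  have := finite_of_extension s
  have := Fintype.ofFinite G
  have := Fintype.ofFinite H
  choose r hrO hr using fun O : {O : Set (ExtensionDual.Dual G) // O ∈ ExtensionDual.orbits s q ∧
    ∃ x ∈ O, ∀ q₁ ∈ ExtensionDual.stab s q x, D.gamma x q₁ q = 1} => O.2.2
  have hrq : ∀ O, act s q (r O) = r O := fun O => act_eq_of_mem_orbits O.2.1 (hrO O)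
  -- `L` pairs a class function with `chi` at the representative of each good orbit.
  let L : ({C : ConjClasses H // ConjClasses.map S.rightHom C = ConjClasses.mk q} → ℂ) →ₗ[ℂ]
      ({O : Set (ExtensionDual.Dual G) // O ∈ ExtensionDual.orbits s q ∧
        ∃ x ∈ O, ∀ q₁ ∈ ExtensionDual.stab s q x, D.gamma x q₁ q = 1} → ℂ) :=
    LinearMap.pi fun O => ∑ h, D.chi q (r O) h • (LinearMap.proj h ∘ₗ Choices.extend q)
  have hL : ∀ f O, L f O = ∑ h, Choices.extend q f h * D.chi q (r O) h := fun f O => by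
    simp [L, LinearMap.sum_apply, mul_comm]
  let φ : {O : Set (ExtensionDual.Dual G) // O ∈ ExtensionDual.orbits s q ∧
        ∃ x ∈ O, ∀ q₁ ∈ ExtensionDual.stab s q x, D.gamma x q₁ q = 1} →
      {C : ConjClasses H // ConjClasses.map S.rightHom C = ConjClasses.mk q} → ℂ :=
    fun O C => Quotient.lift (D.classSum q (r O)) (fun a b hab => by
      obtain ⟨k, rfl⟩ := isConj_iff.1 hab
      rw [← D.classSum_conj q (r O) (k * a * k⁻¹) k]
      congr 1
      group) C.1
  have hLφ : ∀ O O', L (φ O) O' = ∑ h, D.classSum q (r O) h * D.chi q (r O') h := fun O O' => by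
    rw [hL]
    refine Finset.sum_congr rfl fun h _ => ?_
    by_cases hq : S.rightHom h = q
    · rw [Choices.extend_apply hq]
      rfl
    · rw [D.chi_eq_zero hq, mul_zero, mul_zero]
  refine card_eq_of_diagonal L (fun f hf => ?_) φ (fun O => ?_) (fun O O' hne => ?_)
  · have hzero : ∀ x, act s q x = x → ∑ h, Choices.extend q f h * D.chi q x h = 0 := by
      intro x hx
      -- On a good orbit the pairing at `x` is a unit multiple of the one at the representative,
      -- which is zero; on a bad orbit some `γ ≠ 1` at `x` itself kills it.
      by_cases hgood : ∃ y ∈ orbit s q x, ∀ q₁ ∈ stab s q y, D.gamma y q₁ q = 1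
      · have h := congrFun hf ⟨orbit s q x, ⟨x, hx, rfl⟩, hgood⟩
        obtain ⟨p, hp, hpx⟩ := hrO ⟨orbit s q x, ⟨x, hx, rfl⟩, hgood⟩
        rw [hL, ← hpx, D.sum_mul_chi_act (Choices.extend_conj q f) hx hp] at h
        exact (mul_eq_zero.1 h).resolve_left (Circle.coe_ne_zero _)
      · have hbad : ∃ p ∈ stab s q x, D.gamma x p q ≠ 1 := by
          by_contra! hcon
          exact hgood ⟨x, ⟨1, one_mem _, act_one s x⟩, hcon⟩
        obtain ⟨p, hp, hγ⟩ := hbad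
        have h := D.sum_mul_chi_act (Choices.extend_conj q f) hx hp.1
        rw [hp.2] at h
        by_contra hne
        exact hγ (Circle.ext ((mul_eq_right₀ hne).1 h.symm))
    ext ⟨C, hC⟩
    obtain ⟨h, hq, rfl⟩ := exists_eq_mk_of_map_eq S.rightHom_surjective hC
    have := D.eq_zero_of_sum_mul_chi_eq_zero (Choices.extend_conj q f) hzero hq
    rwa [Choices.extend_apply hq] at this
  · rw [hLφ]
    exact D.sum_classSum_mul_chi_self_ne_zero (hrq O) (hr O)
  · rw [hLφ, D.sum_classSum_mul_chi]
    -- A nonzero term would need an element of `C(q)` carrying `r O'` to `r O`, forcing `O = O'`.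
    refine Finset.sum_eq_zero fun k _ =>
      D.sum_chiInv_conj_mul_chi_eq_zero (hrq O) (hrq O') k fun hk hact => hne (Subtype.ext ?_)
    rw [← orbit_eq_of_mem O.2.1 (hrO O), ← orbit_eq_of_mem O'.2.1 (hrO O'), ← hact, orbit_act hk]
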